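/- Let $L/K$ be an extension of (commutative) fields, not assumed algebraic or finitely generated, such that the ring $L\otimes_K L$ is noetherian. Then $L\otimes_K L$ is a regular ring (that is, its localization at every prime ideal is a regular local ring) if and only if $L$ is separable over $K$ (that is, for every field extension $K'$ of $K$ the ring $K'\otimes_K L$ is reduced). -/

import Mathlib

open scoped TensorProduct

universe u v w

/-- A (not necessarily algebraic) field extension `L / K` is separable if for every field
extension `K'` of `K` the ring `K' ⊗[K] L` is reduced. `Algebra.IsSeparable` is not usable here,
as it forces the extension to be algebraic. -/
def IsSeparableExtension (K : Type u) (L : Type v) [Field K] [Field L] [Algebra K L] :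
    Prop :=
  ∀ (K' : Type (max u w)) [Field K'] [Algebra K K'], IsReduced (K' ⊗[K] L)

/-! An intermediate field `E` is recovered from the ideal of `L ⊗[K] L` generated by all `1 ⊗ x - x
⊗ 1`, `x ∈ E`; so noetherianity makes `L / K` finitely generated. Both directions pass through
separable generation. If `L` is finite separable over `K(t)`, then `K(t) ⊗[K] F` is a localization
of `F[t]`, hence a regular domain, and `L ⊗[K] F` is flat and unramified over it: it is regular and
reduced. A reduced base change to an algebraic closure gives separable generation. If instead `L
⊗[K] L` is regular, let `I` be the kernel of multiplication: `dim Ω[L⁄K] = dim I/I²` is at most the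
embedding dimension at `I`, which equals the local dimension and so is at most the transcendence
degree. Elements whose differentials form a basis of `Ω[L⁄K]` are then a separating transcendence
basis. -/

section Regular

/-- A localization of a regular ring is regular. -/
theorem IsRegularRing.of_isLocalization {R S : Type*} [CommRing R] [CommRing S] [Algebra R S]
    (M : Submonoid R) [IsLocalization M S] [IsRegularRing R] : IsRegularRing S := by
  have : IsNoetherianRing S := IsLocalization.isNoetherianRing M S inferInstance
  refine isRegularRing_iff.mpr fun p _ ↦ ?_
  have := IsLocalization.isLocalization_isLocalization_atPrime_isLocalization M
    (Localization.AtPrime p) p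
  exact IsRegularLocalRing.of_ringEquiv (IsLocalization.algEquiv
    (p.comap (algebraMap R S)).primeCompl
    (Localization.AtPrime (p.comap (algebraMap R S))) (Localization.AtPrime p)).toRingEquiv

open IsLocalRing in
/-- A flat unramified algebra that is essentially of finite type over a regular ring is regular. -/
theorem IsRegularRing.of_flat_of_formallyUnramified (R S : Type*) [CommRing R] [CommRing S]
    [Algebra R S] [Module.Flat R S] [Algebra.EssFiniteType R S] [Algebra.FormallyUnramified R S]
    [IsRegularRing R] : IsRegularRing S := by
  have : IsNoetherianRing S := Algebra.EssFiniteType.isNoetherianRing R S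
  refine isRegularRing_iff.mpr fun q _ ↦ ?_
  let p := q.under R
  let := Localization.AtPrime.algebraOfLiesOver p q
  have hmap : (maximalIdeal (Localization.AtPrime p)).map
      (algebraMap (Localization.AtPrime p) (Localization.AtPrime q)) =
      maximalIdeal (Localization.AtPrime q) := by
    have : Algebra.EssFiniteType (Localization.AtPrime p) (Localization.AtPrime q) := .of_comp R _ _
    have : Algebra.FormallyUnramified R (Localization.AtPrime q) := .comp R S _
    have : Algebra.FormallyUnramified (Localization.AtPrime p) (Localization.AtPrime q) :=
      .of_restrictScalars R _ _
    exact Algebra.FormallyUnramified.map_maximalIdeal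
  -- Generators at `p` also generate at `q`, so at most `height p` are needed, and going down gives
  -- `height p ≤ height q`.
  refine IsRegularLocalRing.of_spanFinrank_maximalIdeal_le _ ?_
  have h1 := Ideal.height_eq_height_add_of_liesOver_of_hasGoingDown p q
  rw [IsLocalization.AtPrime.ringKrullDim_eq_height q, h1, ← hmap]
  refine le_trans (Nat.cast_le.mpr (Ideal.spanFinrank_map_le_of_fg _
    (Ideal.fg_of_isNoetherianRing _))) ?_
  rw [IsRegularLocalRing.spanFinrank_maximalIdeal,
    IsLocalization.AtPrime.ringKrullDim_eq_height p]
  exact WithBot.coe_le_coe.mpr le_self_add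

/-- An integral extension does not raise the Krull dimension. -/
theorem ringKrullDim_le_of_isIntegral (R S : Type*) [CommRing R] [CommRing S] [Algebra R S]
    [Algebra.IsIntegral R S] : ringKrullDim S ≤ ringKrullDim R :=
  Order.krullDim_le_of_strictMono (PrimeSpectrum.comap (algebraMap R S))
    fun _ _ h ↦ Ideal.IsIntegral.comap_lt_comap h

theorem ringKrullDim_le_of_isLocalization {R : Type*} (S : Type*) [CommRing R] [CommRing S]
    [Algebra R S] (M : Submonoid R) [IsLocalization M S] : ringKrullDim S ≤ ringKrullDim R :=
  Order.krullDim_le_of_strictMono (PrimeSpectrum.comap (algebraMap R S))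
    fun _ _ h ↦ (IsLocalization.orderEmbedding M S).strictMono h

end Regular

/-- The base change of `k → F` to `L`, done in two steps through `E`. -/
noncomputable def Algebra.TensorProduct.cancelBaseChangeComm (k E L F : Type*) [CommRing k]
    [CommRing E] [CommRing L] [CommRing F] [Algebra k E] [Algebra k L] [Algebra E L]
    [IsScalarTower k E L] [Algebra k F] : (E ⊗[k] F) ⊗[E] L ≃+* L ⊗[k] F :=
  ((Algebra.TensorProduct.comm E (E ⊗[k] F) L).trans
    (Algebra.TensorProduct.cancelBaseChange k E E L F)).toRingEquiv

/-! ### Base change of purely transcendental extensions -/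

section PurelyTranscendental

open Algebra.TensorProduct

variable {k P σ : Type*} [Field k] [CommRing P] [Algebra k P]

/-- Base change of a polynomial ring along `k → F`. -/
noncomputable def MvPolynomial.tensorEquivOfEquiv (e : P ≃ₐ[k] MvPolynomial σ k)
    (F : Type*) [Field F] [Algebra k F] : P ⊗[k] F ≃+* MvPolynomial σ F :=
  ((Algebra.TensorProduct.comm k P F).trans (congr .refl e)).toRingEquiv.trans
    (scalarRTensorAlgEquiv (R := k) (N := F) (σ := σ)).toRingEquiv

variable {E : Type*} [Field E] [Algebra k E] [Algebra P E] [IsScalarTower k P E]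
  [IsFractionRing P E] (F : Type*) [Field F] [Algebra k F]

theorem IsRegularRing.tensorProduct_of_mvPolynomial [Finite σ] (e : P ≃ₐ[k] MvPolynomial σ k) :
    IsRegularRing (E ⊗[k] F) := by
  have : IsRegularRing (P ⊗[k] F) := .of_ringEquiv (MvPolynomial.tensorEquivOfEquiv e F).symm
  have : IsRegularRing ((P ⊗[k] F) ⊗[P] E) :=
    .of_isLocalization (Algebra.algebraMapSubmonoid (P ⊗[k] F) (nonZeroDivisors P))
  exact .of_ringEquiv (cancelBaseChangeComm k P E F)

theorem ringKrullDim_tensorProduct_le_of_mvPolynomial [Finite σ]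
    (e : P ≃ₐ[k] MvPolynomial σ k) : ringKrullDim (E ⊗[k] F) ≤ Nat.card σ := by
  rw [← ringKrullDim_eq_of_ringEquiv (cancelBaseChangeComm k P E F)]
  refine (ringKrullDim_le_of_isLocalization _
    (Algebra.algebraMapSubmonoid (P ⊗[k] F) (nonZeroDivisors P))).trans ?_
  rw [ringKrullDim_eq_of_ringEquiv (MvPolynomial.tensorEquivOfEquiv e F),
    MvPolynomial.ringKrullDim_of_isNoetherianRing, ringKrullDim_eq_zero_of_field, zero_add]

theorem isDomain_tensorProduct_of_mvPolynomial (e : P ≃ₐ[k] MvPolynomial σ k) :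
    IsDomain (E ⊗[k] F) := by
  have : IsDomain (P ⊗[k] F) := (MvPolynomial.tensorEquivOfEquiv e F).toMulEquiv.isDomain _
  have : IsDomain P := e.toMulEquiv.isDomain _
  have : IsDomain ((P ⊗[k] F) ⊗[P] E) := by
    refine IsLocalization.isDomain_of_le_nonZeroDivisors _
      (M := Algebra.algebraMapSubmonoid (P ⊗[k] F) (nonZeroDivisors P)) ?_
    refine map_le_nonZeroDivisors_of_injective _ ?_ le_rfl
    exact includeLeft_injective (S := P) (algebraMap k F).injective
  exact (cancelBaseChangeComm k P E F).symm.toMulEquiv.isDomain _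

end PurelyTranscendental

/-! ### Base change of separably generated extensions -/

section Separable

open Algebra.TensorProduct

section Tower

variable (K E L : Type*) [Field K] [Field E] [Field L] [Algebra K E] [Algebra E L] [Algebra K L]
  [IsScalarTower K E L] (F : Type*) [Field F] [Algebra K F]

theorem IsRegularRing.tensorProduct_of_isSeparable [Algebra.EssFiniteType E L]
    [Algebra.IsSeparable E L] [IsRegularRing (E ⊗[K] F)] : IsRegularRing (L ⊗[K] F) := by
  have : Algebra.FormallyUnramified E L := .of_isSeparable _ _
  have := IsRegularRing.of_flat_of_formallyUnramified (E ⊗[K] F) ((E ⊗[K] F) ⊗[E] L)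
  exact .of_ringEquiv (cancelBaseChangeComm K E L F)

/-- By flatness of `L` over `E`, the ring embeds in `Q ⊗[E] L` with `Q = Frac (E ⊗[K] F)`, which is
unramified over a field. -/
theorem isReduced_tensorProduct_of_isSeparable [Algebra.EssFiniteType E L]
    [Algebra.IsSeparable E L] [IsDomain (E ⊗[K] F)] : IsReduced (L ⊗[K] F) := by
  have : Algebra.FormallyUnramified E L := .of_isSeparable _ _
  let Q := FractionRing (E ⊗[K] F)
  have : IsReduced (Q ⊗[E] L) := Algebra.FormallyUnramified.isReduced_of_field Q _
  have : IsReduced ((E ⊗[K] F) ⊗[E] L) :=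
    isReduced_of_injective (Algebra.TensorProduct.map (IsScalarTower.toAlgHom E (E ⊗[K] F) Q)
      (AlgHom.id E L)) <| Module.Flat.rTensor_preserves_injective_linearMap
        (IsScalarTower.toAlgHom E (E ⊗[K] F) Q).toLinearMap (IsFractionRing.injective _ Q)
  exact isReduced_of_injective (cancelBaseChangeComm K E L F).symm
    (cancelBaseChangeComm K E L F).symm.injective

theorem ringKrullDim_tensorProduct_le_of_isAlgebraic [Algebra.IsAlgebraic E L] :
    ringKrullDim (L ⊗[K] F) ≤ ringKrullDim (E ⊗[K] F) := by
  rw [← ringKrullDim_eq_of_ringEquiv (cancelBaseChangeComm K E L F)]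
  exact ringKrullDim_le_of_isIntegral _ _

end Tower

open IntermediateField
open scoped IntermediateField.algebraAdjoinAdjoin

variable {K L : Type*} [Field K] [Field L] [Algebra K L] {ι : Type*} {v : ι → L}
  (F : Type*) [Field F] [Algebra K F]

/-- The tensor product of a separably generated field extension with a field is regular. -/
theorem AlgebraicIndependent.isRegularRing_tensorProduct (hv : AlgebraicIndependent K v)
    [Finite ι] [Algebra.EssFiniteType K L]
    [Algebra.IsSeparable (adjoin K (Set.range v)) L] : IsRegularRing (L ⊗[K] F) := by
  have := IsRegularRing.tensorProduct_of_mvPolynomial (E := adjoin K (Set.range v)) F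
    hv.aevalEquiv.symm
  have : Algebra.EssFiniteType (adjoin K (Set.range v)) L := .of_comp K _ _
  exact IsRegularRing.tensorProduct_of_isSeparable K (adjoin K (Set.range v)) L F

/-- The tensor product of a separably generated field extension with a field is reduced. -/
theorem AlgebraicIndependent.isReduced_tensorProduct (hv : AlgebraicIndependent K v)
    [Algebra.EssFiniteType K L]
    [Algebra.IsSeparable (adjoin K (Set.range v)) L] : IsReduced (L ⊗[K] F) := by
  have := isDomain_tensorProduct_of_mvPolynomial (E := adjoin K (Set.range v)) F
    hv.aevalEquiv.symm
  have : Algebra.EssFiniteType (adjoin K (Set.range v)) L := .of_comp K _ _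
  exact isReduced_tensorProduct_of_isSeparable K (adjoin K (Set.range v)) L F

/-- The tensor product of a field extension with a field has Krull dimension at most the
transcendence degree of the extension. -/
theorem IsTranscendenceBasis.ringKrullDim_tensorProduct_le (hv : IsTranscendenceBasis K v)
    [Finite ι] : ringKrullDim (L ⊗[K] F) ≤ Nat.card ι := by
  have := hv.isAlgebraic_field
  exact (ringKrullDim_tensorProduct_le_of_isAlgebraic K (adjoin K (Set.range v)) L F).trans
    (ringKrullDim_tensorProduct_le_of_mvPolynomial F hv.1.aevalEquiv.symm)

end Separable

/-! ### Noetherianity forces finite generation -/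

section FinitelyGenerated

variable {K L : Type*} [Field K] [Field L] [Algebra K L]

/-- Otherwise a `K`-linear functional kills `1` but not `x`; applied to the left factor, it
separates the two tensors. -/
theorem Algebra.TensorProduct.mem_range_algebraMap_of_tmul_comm {x : L}
    (h : (1 : L) ⊗ₜ[K] x = x ⊗ₜ[K] (1 : L)) : x ∈ (algebraMap K L).range := by
  by_contra hx
  have hx' : x ∉ Submodule.span K {(1 : L)} := by
    rw [Submodule.mem_span_singleton]
    rintro ⟨a, rfl⟩
    exact hx ⟨a, by simp [Algebra.smul_def]⟩
  obtain ⟨f, hfx, hf⟩ := Submodule.exists_le_ker_of_notMem hx'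
  have hf1 : f 1 = 0 := hf (Submodule.mem_span_singleton_self 1)
  have := congr(TensorProduct.lid K L (f.rTensor L $h))
  simp only [LinearMap.rTensor_tmul, hf1, TensorProduct.lid_tmul, zero_smul] at this
  exact hfx (by simpa using this.symm)

/-- The ideal of `L ⊗[K] L` generated by the differences `1 ⊗ x - x ⊗ 1` with `x ∈ E`. -/
def IntermediateField.diagonalIdeal (E : IntermediateField K L) : Ideal (L ⊗[K] L) :=
  Ideal.span ((fun x : L ↦ 1 ⊗ₜ[K] x - x ⊗ₜ[K] 1) '' E)

/-- The map to `L ⊗[E] L` kills the ideal, so the previous lemma applies over `E`. -/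
theorem IntermediateField.mem_of_mem_diagonalIdeal {E : IntermediateField K L} {x : L}
    (h : 1 ⊗ₜ[K] x - x ⊗ₜ[K] 1 ∈ E.diagonalIdeal) : x ∈ E := by
  let f : L ⊗[K] L →ₐ[K] L ⊗[E] L := Algebra.TensorProduct.productMap
    ((Algebra.TensorProduct.includeLeft : L →ₐ[E] L ⊗[E] L).restrictScalars K)
    ((Algebra.TensorProduct.includeRight : L →ₐ[E] L ⊗[E] L).restrictScalars K)
  have hf (y : L) : f (1 ⊗ₜ y - y ⊗ₜ 1) = 1 ⊗ₜ y - y ⊗ₜ 1 := by simp [f]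
  have hle : E.diagonalIdeal ≤ RingHom.ker f := by
    rw [diagonalIdeal, Ideal.span_le]
    rintro _ ⟨y, hy, rfl⟩
    rw [SetLike.mem_coe, RingHom.mem_ker, hf, sub_eq_zero]
    have := TensorProduct.smul_tmul (R := E) (R' := E) ⟨y, hy⟩ (1 : L) (1 : L)
    simpa [Algebra.smul_def] using this.symm
  have := hle h
  rw [RingHom.mem_ker, hf, sub_eq_zero] at this
  obtain ⟨y, rfl⟩ := Algebra.TensorProduct.mem_range_algebraMap_of_tmul_comm this
  exact y.2

theorem IntermediateField.strictMono_diagonalIdeal :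
    StrictMono (diagonalIdeal : IntermediateField K L → Ideal (L ⊗[K] L)) := by
  refine Monotone.strictMono_of_injective
    (fun E F h ↦ Ideal.span_mono (Set.image_mono h)) fun E F h ↦ ?_
  ext x
  have (E : IntermediateField K L) : x ∈ E ↔ 1 ⊗ₜ[K] x - x ⊗ₜ[K] 1 ∈ E.diagonalIdeal :=
    ⟨fun hx ↦ Ideal.subset_span ⟨x, hx, rfl⟩, mem_of_mem_diagonalIdeal⟩
  rw [this, this, h]

variable (K L) in
/-- If `L ⊗[K] L` is noetherian, then `L` is a finitely generated field extension of `K`. -/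
theorem Algebra.EssFiniteType.of_isNoetherianRing_tensorProduct [IsNoetherianRing (L ⊗[K] L)] :
    Algebra.EssFiniteType K L := by
  rw [← IntermediateField.fg_top_iff]
  have hwf : WellFoundedGT (IntermediateField K L) :=
    IntermediateField.strictMono_diagonalIdeal.wellFoundedGT
  obtain ⟨E, hE, hmax⟩ := hwf.wf.has_min {E : IntermediateField K L | E.FG}
    ⟨⊥, IntermediateField.fg_bot⟩
  suffices E = ⊤ from this ▸ hE
  refine SetLike.ext fun x ↦ iff_of_true (by_contra fun hx ↦ ?_) trivial
  refine hmax (E ⊔ IntermediateField.adjoin K {x})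
    (IntermediateField.fg_sup hE (IntermediateField.fg_adjoin_of_finite (Set.finite_singleton x))) ?_
  refine lt_of_le_of_ne le_sup_left fun h ↦ hx ?_
  rw [h]
  exact le_sup_right (a := E) (IntermediateField.mem_adjoin_simple_self K x)

end FinitelyGenerated

section Reduced

variable {K L : Type*} [Field K] [Field L] [Algebra K L]

/-- If `F ⊗[K] L` is reduced for an algebraically closed field `F`, then taking `p`-th powers
preserves linear independence in `L` over `K`. -/
theorem LinearIndepOn.pow_of_isReduced_tensorProduct (F : Type*) [Field F] [Algebra K F]
    [IsAlgClosed F] [IsReduced (F ⊗[K] L)] (p : ℕ) [ExpChar K p] (s : Finset L)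
    (hs : LinearIndepOn K id (s : Set L)) : LinearIndepOn K (· ^ p) (s : Set L) := by
  have : ExpChar F p := expChar_of_injective_algebraMap (algebraMap K F).injective p
  have : ExpChar (F ⊗[K] L) p :=
    expChar_of_injective_algebraMap (algebraMap K (F ⊗[K] L)).injective p
  have hp : 0 < p := expChar_pos K p
  rw [linearIndepOn_finset_iff]
  intro c hc x hx
  -- With `p`-th roots `d x` of the coefficients, the relation among `p`-th powers is the `p`-th
  -- power of `∑ d x ⊗ x`, which vanishes by reducedness.
  choose d hd using fun x ↦ IsAlgClosed.exists_pow_nat_eq (algebraMap K F (c x)) hp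
  have hzero : ∑ x ∈ s, d x ⊗ₜ[K] x = 0 := by
    refine eq_zero_of_pow_eq_zero (n := p) ?_
    rw [sum_pow_char p]
    calc ∑ x ∈ s, (d x ⊗ₜ[K] x) ^ p = ∑ x ∈ s, 1 ⊗ₜ[K] (c x • x ^ p) := by
          refine Finset.sum_congr rfl fun x _ ↦ ?_
          rw [Algebra.TensorProduct.tmul_pow, hd, Algebra.algebraMap_eq_smul_one,
            TensorProduct.smul_tmul]
      _ = 0 := by rw [← TensorProduct.tmul_sum, hc, TensorProduct.tmul_zero]
  have hind := Module.Flat.linearIndependent_one_tmul (S := F) (LinearIndepOn.linearIndependent hs)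
  have hdx := Fintype.linearIndependent_iff.mp hind (fun x ↦ d x) ?_ ⟨x, hx⟩
  · rw [← map_eq_zero (algebraMap K F), ← hd, hdx, zero_pow hp.ne']
  · rw [← hzero, ← Finset.sum_coe_sort s]
    exact Finset.sum_congr rfl fun x _ ↦ by simp [TensorProduct.smul_tmul']

end Reduced

/-! ### Differentials and embedding dimension at the diagonal -/

section Cotangent

/-- Generators of the maximal ideal of `A_I` can be chosen in `I`. -/
theorem Ideal.exists_finite_forall_exists_mul_mem_span {A : Type*} [CommRing A]
    [IsNoetherianRing A] (I : Ideal A) [I.IsPrime] :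
    ∃ t : Set A, t.Finite ∧
      t.ncard ≤ (IsLocalRing.maximalIdeal (Localization.AtPrime I)).spanFinrank ∧ t ⊆ I ∧
      ∀ x ∈ I, ∃ s ∉ I, s * x ∈ Ideal.span t := by
  have hm : (IsLocalRing.maximalIdeal (Localization.AtPrime I)).FG := Ideal.fg_of_isNoetherianRing _
  obtain ⟨G, hG, hcard, hspan⟩ : ∃ G : Set (Localization.AtPrime I), G.Finite ∧
      G.ncard = (IsLocalRing.maximalIdeal (Localization.AtPrime I)).spanFinrank ∧
      Ideal.span G = IsLocalRing.maximalIdeal (Localization.AtPrime I) :=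
    ⟨_, Submodule.FG.finite_generators hm, Submodule.FG.generators_ncard hm,
      Submodule.span_generators _⟩
  have hgen (g : G) : ∃ a ∈ I, ∃ s : I.primeCompl,
      IsLocalization.mk' (Localization.AtPrime I) a s = g := by
    obtain ⟨a, s, h⟩ := IsLocalization.exists_mk'_eq I.primeCompl g.1
    refine ⟨a, ?_, s, h⟩
    have : g.1 ∈ IsLocalRing.maximalIdeal (Localization.AtPrime I) :=
      hspan ▸ Ideal.subset_span g.2
    rw [← h] at this
    exact (IsLocalization.AtPrime.mk'_mem_maximal_iff _ I a s).mp this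
  choose a ha s hs using hgen
  have hle : IsLocalRing.maximalIdeal (Localization.AtPrime I) ≤
      (Ideal.span (Set.range a)).map (algebraMap A _) := by
    rw [← hspan]
    refine Ideal.span_le.mpr fun g hg ↦ ?_
    rw [SetLike.mem_coe, ← show _ = g from hs ⟨g, hg⟩, IsLocalization.mk'_eq_mul_mk'_one]
    exact Ideal.mul_mem_right _ _
      (Ideal.mem_map_of_mem _ (Ideal.subset_span (Set.mem_range_self _)))
  have := hG.to_subtype
  refine ⟨Set.range a, Set.finite_range a, ?_, Set.range_subset_iff.mpr ha, fun x hx ↦ ?_⟩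
  · rw [← hcard, ← Set.image_univ, ← Nat.card_coe_set_eq G, ← Set.ncard_univ]
    exact Set.ncard_image_le
  · have := hle ((IsLocalization.AtPrime.to_map_mem_maximal_iff _ I x).mpr hx)
    rwa [IsLocalization.algebraMap_mem_map_algebraMap_iff I.primeCompl] at this

variable {K L : Type*} [Field K] [Field L] [Algebra K L]

/-- `r` and its product differ by an element of the diagonal ideal, which annihilates `I/I²`. -/
theorem KaehlerDifferential.smul_eq_lmul'_smul (r : L ⊗[K] L) (ω : Ω[L⁄K]) :
    r • ω = Algebra.TensorProduct.lmul' (S := L) K r • ω := by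
  rw [← algebraMap_smul (L ⊗[K] L) (Algebra.TensorProduct.lmul' (S := L) K r) ω, ← sub_eq_zero,
    ← sub_smul]
  refine Ideal.Cotangent.smul_eq_zero_of_mem (I := KaehlerDifferential.ideal K L) ?_ ω
  simp [KaehlerDifferential.ideal, RingHom.mem_ker]

instance KaehlerDifferential.isPrime_ideal : (KaehlerDifferential.ideal K L).IsPrime :=
  RingHom.ker_isPrime _

variable (K L) in
theorem KaehlerDifferential.finrank_le_spanFinrank [IsNoetherianRing (L ⊗[K] L)] :
    Module.finrank L Ω[L⁄K] ≤ (IsLocalRing.maximalIdeal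
      (Localization.AtPrime (KaehlerDifferential.ideal K L))).spanFinrank := by
  obtain ⟨t, htfin, htcard, htI, ht⟩ :=
    (KaehlerDifferential.ideal K L).exists_finite_forall_exists_mul_mem_span
  refine le_trans ?_ htcard
  have := htfin.to_subtype
  have := Fintype.ofFinite t
  let w : t → Ω[L⁄K] := fun y ↦ KaehlerDifferential.fromIdeal K L ⟨y, htI y.2⟩
  have hle : Ideal.span t ≤ KaehlerDifferential.ideal K L := Ideal.span_le.mpr htI
  have hmem (y) (hy : y ∈ Ideal.span t) :
      KaehlerDifferential.fromIdeal K L ⟨y, hle hy⟩ ∈ Submodule.span L (Set.range w) := by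
    induction hy using Submodule.span_induction with
    | mem y hy => exact Submodule.subset_span ⟨⟨y, hy⟩, rfl⟩
    | zero => exact (map_zero (KaehlerDifferential.fromIdeal K L)).symm ▸ zero_mem _
    | add y z hy hz h₁ h₂ =>
      have := add_mem h₁ h₂
      rwa [← map_add] at this
    | smul r y hy h =>
      have := Submodule.smul_mem _ (Algebra.TensorProduct.lmul' (S := L) K r) h
      rwa [← smul_eq_lmul'_smul, ← map_smul] at this
  have hspan : Submodule.span L (Set.range w) = ⊤ := by
    refine eq_top_iff.mpr fun ω _ ↦ ?_
    obtain ⟨x, rfl⟩ := KaehlerDifferential.fromIdeal_surjective K L ω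
    obtain ⟨s, hs, hsx⟩ := ht x x.2
    have := hmem _ hsx
    -- Since `s ∉ I`, it acts on `Ω[L⁄K]` as a nonzero scalar of `L`, which can be cancelled.
    rw [show (⟨s * x, hle hsx⟩ : KaehlerDifferential.ideal K L) = s • x from rfl, map_smul,
      smul_eq_lmul'_smul] at this
    exact (Submodule.smul_mem_iff _ fun h ↦ hs h).mp this
  rw [← finrank_top, ← hspan, ← Nat.card_coe_set_eq, Nat.card_eq_fintype_card]
  exact finrank_range_le_card w

end Cotangent

/-! ### Criteria for separable generation -/

section SeparablyGenerated

open IntermediateField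

variable (K L : Type*) [Field K] [Field L] [Algebra K L]

/-- A finitely generated extension `L / K` is separably generated if `F ⊗[K] L` is reduced for
some algebraically closed field `F` containing `K`. -/
theorem exists_isTranscendenceBasis_and_isSeparable_of_isReduced_tensorProduct
    [Algebra.EssFiniteType K L] (F : Type*) [Field F] [Algebra K F] [IsAlgClosed F]
    [IsReduced (F ⊗[K] L)] :
    ∃ s : Finset L, IsTranscendenceBasis K ((↑) : s → L) ∧
      Algebra.IsSeparable (adjoin K (s : Set L)) L := by
  obtain _ | ⟨p, hp, _⟩ := CharP.exists' K
  · exact exists_isTranscendenceBasis_and_isSeparable_of_perfectField K L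
  · have : ExpChar K p := .prime hp.out
    exact exists_isTranscendenceBasis_and_isSeparable_of_linearIndepOn_pow_of_essFiniteType p
      hp.out (LinearIndepOn.pow_of_isReduced_tensorProduct F p)

variable {K L}

/-- The surjection from `Ω[L⁄K]` onto the differentials over `K(s)` kills every `dx`, `x ∈ s`. -/
theorem Algebra.FormallyUnramified.adjoin_of_span_eq_top {s : Set L}
    (hs : Submodule.span L (KaehlerDifferential.D K L '' s) = ⊤) :
    Algebra.FormallyUnramified (IntermediateField.adjoin K s) L := by
  constructor
  have hzero : KaehlerDifferential.map K (IntermediateField.adjoin K s) L L = 0 := by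
    refine LinearMap.ext_on hs ?_
    rintro _ ⟨x, hx, rfl⟩
    rw [KaehlerDifferential.map_D, LinearMap.zero_apply]
    exact (KaehlerDifferential.D (IntermediateField.adjoin K s) L).map_algebraMap ⟨x, IntermediateField.subset_adjoin K s hx⟩
  refine subsingleton_of_forall_eq 0 fun ω ↦ ?_
  obtain ⟨η, rfl⟩ := KaehlerDifferential.map_surjective K (IntermediateField.adjoin K s) L ω
  rw [hzero, LinearMap.zero_apply]

/-- If `Ω[L⁄K]` has dimension at most the transcendence degree of the finitely generated
extension `L / K`, then `L / K` is separably generated. -/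
theorem IsTranscendenceBasis.exists_isSeparable_of_finrank_le [Algebra.EssFiniteType K L]
    {ι : Type*} [Finite ι] {v : ι → L} (hv : IsTranscendenceBasis K v)
    (h : Module.finrank L Ω[L⁄K] ≤ Nat.card ι) :
    ∃ s : Set L, IsTranscendenceBasis K ((↑) : s → L) ∧ Algebra.IsSeparable (adjoin K s) L := by
  obtain ⟨f, hf, hspan, -⟩ := Submodule.exists_fun_fin_finrank_span_eq L
    (Set.range (KaehlerDifferential.D K L))
  choose b hb using hf
  have : Algebra.FormallyUnramified (adjoin K (Set.range b)) L := by
    refine Algebra.FormallyUnramified.adjoin_of_span_eq_top ?_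
    rw [← Set.range_comp, show KaehlerDifferential.D K L ∘ b = f from funext hb, hspan,
      KaehlerDifferential.span_range_derivation]
  have : Algebra.EssFiniteType (adjoin K (Set.range b)) L := .of_comp K _ _
  have hsep := Algebra.FormallyUnramified.isSeparable (adjoin K (Set.range b)) L
  have : Algebra.IsAlgebraic (Algebra.adjoin K (Set.range b)) L :=
    isAlgebraic_adjoin_iff_top.mp inferInstance
  obtain ⟨t, htb, ht⟩ := exists_isTranscendenceBasis_subset (R := K) (Set.range b)
  have htcard : Nat.card ι = t.ncard := by
    have := congr(Cardinal.toNat $(hv.lift_cardinalMk_eq ht))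
    simpa [Nat.card, ← Nat.card_coe_set_eq] using this
  -- `Set.range b` has at most `finrank Ω[L⁄K] ≤ Nat.card ι = t.ncard` elements.
  have : t = Set.range b := by
    refine Set.eq_of_subset_of_ncard_le htb ?_
    rw [← htcard]
    refine le_trans ?_ h
    rw [← Set.image_univ]
    refine (Set.ncard_image_le Set.finite_univ).trans ?_
    rw [Set.ncard_univ, Nat.card_eq_fintype_card, Fintype.card_fin,
      KaehlerDifferential.span_range_derivation, finrank_top]
  exact ⟨t, ht, this ▸ hsep⟩

variable (K L) in
theorem KaehlerDifferential.finrank_le_of_isRegularRing [IsRegularRing (L ⊗[K] L)]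
    {ι : Type*} [Finite ι] {v : ι → L} (hv : IsTranscendenceBasis K v) :
    Module.finrank L Ω[L⁄K] ≤ Nat.card ι := by
  have h := calc
    ((Module.finrank L Ω[L⁄K] : ℕ) : WithBot ℕ∞)
    _ ≤ _ := Nat.cast_le.mpr (finrank_le_spanFinrank K L)
    _ = ringKrullDim (Localization.AtPrime (KaehlerDifferential.ideal K L)) :=
      IsRegularLocalRing.spanFinrank_maximalIdeal
    _ ≤ ringKrullDim (L ⊗[K] L) :=
      ringKrullDim_le_of_isLocalization _ (KaehlerDifferential.ideal K L).primeCompl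
    _ ≤ Nat.card ι := hv.ringKrullDim_tensorProduct_le L
  exact_mod_cast h

end SeparablyGenerated

theorem mainTheorem6 (K : Type u) (L : Type v) [Field K] [Field L] [Algebra K L]
    [IsNoetherianRing (L ⊗[K] L)] :
    IsRegularRing (L ⊗[K] L) ↔ IsSeparableExtension.{u, v, w} K L := by
  have := Algebra.EssFiniteType.of_isNoetherianRing_tensorProduct K L
  refine ⟨fun _ K' _ _ ↦ ?_, fun h ↦ ?_⟩
  · obtain ⟨s, hs⟩ := exists_isTranscendenceBasis K L
    have : Finite s := finite_of_isTranscendenceBasis hs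
    obtain ⟨t, ht, hsep⟩ := hs.exists_isSeparable_of_finrank_le
      (KaehlerDifferential.finrank_le_of_isRegularRing K L hs)
    have : Algebra.IsSeparable (IntermediateField.adjoin K (Set.range ((↑) : t → L))) L := by
      rwa [Subtype.range_coe]
    have := ht.1.isReduced_tensorProduct K'
    exact isReduced_of_injective (Algebra.TensorProduct.comm K K' L)
      (Algebra.TensorProduct.comm K K' L).injective
  -- The test fields live in `Type (max u w)`, so the closure is lifted there and brought back.
  · have := h (ULift.{max u w} (AlgebraicClosure K))
    have : IsReduced (AlgebraicClosure K ⊗[K] L) := isReduced_of_injective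
      (Algebra.TensorProduct.congr (ULift.algEquiv (R := K) (A := AlgebraicClosure K)).symm
        (AlgEquiv.refl (R := K) (A₁ := L)))
      (AlgEquiv.injective _)
    obtain ⟨s, hs, hsep⟩ :=
      exists_isTranscendenceBasis_and_isSeparable_of_isReduced_tensorProduct K L
        (AlgebraicClosure K)
    have : Algebra.IsSeparable (IntermediateField.adjoin K (Set.range ((↑) : s → L))) L := by
      convert! hsep <;> simp
    exact hs.1.isRegularRing_tensorProduct L
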